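/- Let $D$ be an integral domain with quotient field $K$, and let $\overline{\boldsymbol F}(D)$ be the set of all $D$-submodules of $K$. A semistar operation on $D$ is a map $\star:\overline{\boldsymbol F}(D)\to\overline{\boldsymbol F}(D)$, $I\mapsto I^\star$, such that for all $I,J\in\overline{\boldsymbol F}(D)$ and $x\in K$: $I\subseteq I^\star$; $I\subseteq J$ implies $I^\star\subseteq J^\star$; $(I^\star)^\star=I^\star$; and $xI^\star=(xI)^\star$. It is stable if $(I\cap J)^\star=I^\star\cap J^\star$ for all nonzero $I,J$, and of finite type if $I^\star=\bigcup\{J^\star\mid J\subseteq I,\ J\text{ finitely generated over }D\}$ for every nonzero $I$. Let $\mathrm{SStar}(D)$, the set of semistar operations on $D$, carry the Zariski topology, which has as a subbasis of open sets the sets $\{\star\mid 1\in F^\star\}$ for $F$ a nonzero $D$-submodule of $K$, and let the set $\widetilde{\mathrm{SStar}}(D)$ of stable semistar operations of finite type carry the subspace topology. Let $\mathcal X(D)$ be the set of nonempty subsets $Y$ of $\mathrm{Spec}(D)$ that are closed in the inverse topology, that is, that equal the intersection of all quasi-compact open subsets of $\mathrm{Spec}(D)$ containing $Y$. Let $\mathcal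 X(D)$ carry the Zariski topology, which has as a subbasis of open sets the sets $\{Y\in\mathcal X(D)\mid Y\subseteq\Omega\}$ for $\Omega$ a quasi-compact open subset of $\mathrm{Spec}(D)$. For a nonempty $Y\subseteq\mathrm{Spec}(D)$ let $\mathtt s_Y$ be the map $I\mapsto\bigcap_{P\in Y}ID_P$ on $\overline{\boldsymbol F}(D)$. (1) The map $\mathtt s^\sharp:\mathcal X(D)\to\widetilde{\mathrm{SStar}}(D)$, $Y\mapsto\mathtt s_Y$, and the map $\Delta:\widetilde{\mathrm{SStar}}(D)\to\mathcal X(D)$, $\star\mapsto\mathrm{QSpec}^\star(D):=\{P\in\mathrm{Spec}(D)\mid P^\star\cap D=P\}$, are well defined, are homeomorphisms, and are inverses of each other. (2) The map $\varphi:\mathrm{Spec}(D)\to\mathcal X(D)$, $P\mapsto\{Q\in\mathrm{Spec}(D)\mid Q\subseteq P\}$, and the map $\mathtt s:\mathrm{Spec}(D)\to\widetilde{\mathrm{SStar}}(D)$, $P\mapsto\mathtt s_{\{P\}}$, are well defined, and $\mathtt s^\sharp\circ\varphi=\mathtt s$. -/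

import Mathlib

open scoped Pointwise

/-! ### Nonempty inverse-closed subsets of a space, with the Zariski topology -/

/-- The closure of `Y` in the inverse topology: the intersection of all quasi-compact open sets
containing `Y`. -/
def inverseClosure {X : Type*} [TopologicalSpace X] (Y : Set X) : Set X :=
  ⋂₀ {U : Set X | IsOpen U ∧ IsCompact U ∧ Y ⊆ U}

/-- The closure of `Y` under generizations: all `x` with `x ≤ y` (that is, `y ∈ closure {x}`)
for some `y ∈ Y`. -/
def generizations {X : Type*} [TopologicalSpace X] (Y : Set X) : Set X :=
  {x | ∃ y ∈ Y, y ∈ closure {x}}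

/-- The set of nonempty subsets of `X` that are closed in the inverse topology. -/
@[ext]
structure InverseClosed (X : Type*) [TopologicalSpace X] where
  carrier : Set X
  nonempty : carrier.Nonempty
  inverseClosure_eq : inverseClosure carrier = carrier

/-- The Zariski topology on the set of nonempty inverse-closed subsets: it is generated by the
sets of all `Y ⊆ Ω`, for `Ω` quasi-compact open. -/
instance (X : Type*) [TopologicalSpace X] : TopologicalSpace (InverseClosed X) :=
  TopologicalSpace.generateFrom
    {V | ∃ Ω : Set X, IsOpen Ω ∧ IsCompact Ω ∧ V = {Y : InverseClosed X | Y.carrier ⊆ Ω}}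

/-! ### Semistar operations -/

/-- A semistar operation on an integral domain `D` with quotient field `K`. Here `x • I` is the
submodule `{x * a | a ∈ I}`. -/
@[ext]
structure SemistarOperation (D K : Type*) [CommRing D] [Field K] [Algebra D K] where
  toFun : Submodule D K → Submodule D K
  le_toFun : ∀ I, I ≤ toFun I
  mono : ∀ I J, I ≤ J → toFun I ≤ toFun J
  idem : ∀ I, toFun (toFun I) = toFun I
  smul_toFun : ∀ (x : K) (I : Submodule D K), x • toFun I = toFun (x • I)

namespace SemistarOperation

variable {D K : Type*} [CommRing D] [Field K] [Algebra D K]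

/-- The Zariski topology on the set of semistar operations: it is generated by the sets
`{⋆ | 1 ∈ F^⋆}`, for `F` a nonzero `D`-submodule of `K`. -/
instance : TopologicalSpace (SemistarOperation D K) :=
  TopologicalSpace.generateFrom
    {V | ∃ F : Submodule D K, F ≠ ⊥ ∧ V = {star : SemistarOperation D K | (1 : K) ∈ star.toFun F}}

/-- `(I ∩ J)^⋆ = I^⋆ ∩ J^⋆` for all nonzero `I`, `J`. -/
def IsStable (star : SemistarOperation D K) : Prop :=
  ∀ I J : Submodule D K, I ≠ ⊥ → J ≠ ⊥ → star.toFun (I ⊓ J) = star.toFun I ⊓ star.toFun J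

/-- For all nonzero `I`, the set `I^⋆` is the union of the sets `J^⋆` for `J ⊆ I` finitely
generated. -/
def IsFiniteType (star : SemistarOperation D K) : Prop :=
  ∀ I : Submodule D K, I ≠ ⊥ →
    (star.toFun I : Set K) = ⋃ J ∈ {J : Submodule D K | J ≤ I ∧ J.FG}, (star.toFun J : Set K)

/-- The set of primes `P` of `D` with `P^⋆ ∩ D = P`. The prime `P` is seen as a `D`-submodule
of `K` through its image. -/
def qSpec (star : SemistarOperation D K) : Set (PrimeSpectrum D) :=
  {P | (star.toFun (Submodule.map (Algebra.linearMap D K) P.asIdeal)).comap (Algebra.linearMap D K)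
    = P.asIdeal}

end SemistarOperation

/-- The stable semistar operations of finite type, with the subspace topology. -/
abbrev StableFiniteTypeSemistar (D K : Type*) [CommRing D] [Field K] [Algebra D K] : Type _ :=
  {star : SemistarOperation D K // star.IsStable ∧ star.IsFiniteType}

/-- The localization `D_P`, as a `D`-submodule of the quotient field `K`. -/
noncomputable def localizationAt {D : Type*} (K : Type*) [CommRing D] [IsDomain D] [Field K]
    [Algebra D K] [IsFractionRing D K] (P : PrimeSpectrum D) : Submodule D K :=
  Subalgebra.toSubmodule
    (Localization.subalgebra.ofField K P.asIdeal.primeCompl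
      (Ideal.primeCompl_le_nonZeroDivisors P.asIdeal))

/-- The map `I ↦ ⋂_{P ∈ Y} I D_P` on the `D`-submodules of the quotient field `K`. -/
noncomputable def spectralMap {D : Type*} (K : Type*) [CommRing D] [IsDomain D] [Field K]
    [Algebra D K] [IsFractionRing D K] (Y : Set (PrimeSpectrum D)) (I : Submodule D K) :
    Submodule D K :=
  ⨅ P ∈ Y, I * localizationAt K P

/-! Both sides are governed by colon ideals. An element `x` lies in `I D_P` iff `(I : x) ⊄ P`, so `x
∈ s_Y(I)` iff `Y` lies in the open set `D((I : x))`. A stable `⋆` is determined by the ideals `𝔞`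
with `1 ∈ 𝔞^⋆`: by `IsStable.mem_toFun_iff`, `x ∈ I^⋆` iff `(I : x)` is one of them. These ideals
form an Oka family and, in finite type, are detected on finitely generated subideals; so by Zorn
every ideal outside the family lies in a prime outside it, and those primes are exactly the
quasi-spectrum. Hence `1 ∈ 𝔞^⋆` iff `QSpec^⋆(D) ⊆ D(𝔞)`, which gives `⋆ = s_{QSpec}`. Conversely, an
inverse-closed `Y` is quasi-compact, so `s_Y` has finite type, and stable under generization, so
`QSpec` of `s_Y` is `Y`. The same equivalences match the subbasic open sets. -/

open PrimeSpectrum TopologicalSpace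

/-! ### Inverse-closed sets -/

namespace InverseClosed

variable {X : Type*} [TopologicalSpace X]

/-- Quasi-compact open sets are closed in the constructible topology, which is compact and finer
than the given one; `Y` is an intersection of such sets. -/
theorem isCompact [SpectralSpace X] (Y : InverseClosed X) : IsCompact Y.carrier := by
  let f : WithTopology X (constructibleTopology X) → X := WithTopology.ofTopology
  have hf : Continuous f := by
    refine PrespectralSpace.isTopologicalBasis.continuous_iff.2 ?_
    rintro U ⟨hU, hUc⟩
    rw [WithConstructibleTopology.isOpen_iff]
    exact hUc.isOpen_constructibleTopology_of_isOpen hU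
  have hc : IsClosed (f ⁻¹' Y.carrier) := by
    rw [← Y.inverseClosure_eq, inverseClosure, Set.preimage_sInter]
    refine isClosed_biInter fun U hU ↦ ?_
    rw [WithConstructibleTopology.isClosed_iff, ← @isOpen_compl_iff _ _ (constructibleTopology X)]
    refine IsCompact.isOpen_constructibleTopology_of_isClosed ?_ ?_
    · rw [compl_compl]
      exact hU.2.1
    · exact hU.1.isClosed_compl
  have := hc.isCompact.image hf
  rwa [Set.image_preimage_eq _ (WithTopology.ofTopology_surjective _)] at this

theorem exists_isCompact_isOpen [SpectralSpace X] (Y : InverseClosed X) {U : Set X}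
    (hU : IsOpen U) (hYU : Y.carrier ⊆ U) :
    ∃ Ω, IsOpen Ω ∧ IsCompact Ω ∧ Y.carrier ⊆ Ω ∧ Ω ⊆ U := by
  obtain ⟨Ω, h1, h2, h3, h4⟩ :=
    PrespectralSpace.exists_isCompact_and_isOpen_between Y.isCompact hU hYU
  exact ⟨Ω, h2, h1, h3, h4⟩

theorem mem_of_mem_closure (Y : InverseClosed X) {x y : X} (hy : y ∈ Y.carrier)
    (h : y ∈ closure {x}) : x ∈ Y.carrier := by
  rw [← Y.inverseClosure_eq]
  rintro U ⟨hU, -, hYU⟩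
  obtain ⟨z, hz, rfl⟩ := mem_closure_iff.1 h U hU (hYU hy)
  exact hz

/-- Since `Y` is quasi-compact, a quasi-compact open set fits between `Y` and `U`. This covers `U =
D((F : 1))`, where the colon ideal need not be finitely generated. -/
theorem isOpen_setOf_subset [SpectralSpace X] {U : Set X} (hU : IsOpen U) :
    IsOpen {Y : InverseClosed X | Y.carrier ⊆ U} := by
  have : {Y : InverseClosed X | Y.carrier ⊆ U} =
      ⋃ Ω ∈ {Ω : Set X | IsOpen Ω ∧ IsCompact Ω ∧ Ω ⊆ U},
        {Y : InverseClosed X | Y.carrier ⊆ Ω} := by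
    ext Y
    simp only [Set.mem_ofPred_eq, Set.mem_iUnion, exists_prop]
    constructor
    · intro h
      obtain ⟨Ω, h1, h2, h3, h4⟩ := Y.exists_isCompact_isOpen hU h
      exact ⟨Ω, ⟨h1, h2, h4⟩, h3⟩
    · rintro ⟨Ω, ⟨-, -, h4⟩, h3⟩
      exact h3.trans h4
  rw [this]
  exact isOpen_biUnion fun Ω hΩ ↦ isOpen_generateFrom_of_mem ⟨Ω, hΩ.1, hΩ.2.1, rfl⟩

end InverseClosed

theorem PrimeSpectrum.mem_generizations_singleton {R : Type*} [CommRing R]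
    {P Q : PrimeSpectrum R} : Q ∈ generizations {P} ↔ Q ≤ P := by
  simp [generizations, le_iff_mem_closure]

/-- The inverse-closed set of all primes contained in `P`. -/
def InverseClosed.down {R : Type*} [CommRing R] (P : PrimeSpectrum R) :
    InverseClosed (PrimeSpectrum R) where
  carrier := generizations {P}
  nonempty := ⟨P, mem_generizations_singleton.2 le_rfl⟩
  inverseClosure_eq := by
    refine Set.Subset.antisymm (fun Q hQ ↦ ?_) fun Q hQ U hU ↦ hU.2.2 hQ
    rw [mem_generizations_singleton]
    intro f hf
    by_contra hfP
    refine hQ (basicOpen f) ⟨isOpen_basicOpen, isCompact_basicOpen f, ?_⟩ hf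
    intro Q' hQ' hf'
    exact hfP (mem_generizations_singleton.1 hQ' hf')

theorem Submodule.zero_pointwise_smul {R S M : Type*} [Semiring R] [Semiring S] [AddCommMonoid M]
    [Module R M] [Module S M] [SMulCommClass S R M] (N : Submodule R M) : (0 : S) • N = ⊥ := by
  rw [eq_bot_iff]
  intro y hy
  obtain ⟨z, -, rfl⟩ := (Submodule.mem_smul_pointwise_iff_exists _ _ _).1 hy
  simp

/-! ### The spectral map in terms of colon ideals -/

section SpectralMap

variable {D : Type*} (K : Type*) [CommRing D] [IsDomain D] [Field K] [Algebra D K]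
  [IsFractionRing D K]

/-- An element of `I D_P` has a single denominator outside `P`, because the complement of `P` is
multiplicative. -/
theorem mem_mul_localizationAt {P : PrimeSpectrum D} {I : Submodule D K} {x : K} :
    x ∈ I * localizationAt K P ↔ ¬ I.colon {x} ≤ P.asIdeal := by
  have hmem : ∀ {y : K}, y ∈ localizationAt K P ↔ ∃ (a s : D) (_ : s ∈ P.asIdeal.primeCompl),
    y = algebraMap D K a * (algebraMap D K s)⁻¹ := Iff.rfl
  rw [SetLike.not_le_iff_exists]
  simp only [Submodule.mem_colon_singleton]
  constructor
  · intro hx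
    induction hx using Submodule.mul_induction_on' with
    | mem_mul_mem m hm n hn =>
      obtain ⟨a, s, hs, rfl⟩ := hmem.1 hn
      refine ⟨s, ?_, hs⟩
      have hs0 : algebraMap D K s ≠ 0 := fun h ↦ hs (by
        rw [(FaithfulSMul.algebraMap_eq_zero_iff D K).1 h]; exact zero_mem _)
      have : s • (m * (algebraMap D K a * (algebraMap D K s)⁻¹)) = a • m := by
        rw [Algebra.smul_def, Algebra.smul_def]
        field_simp
      rw [this]
      exact I.smul_mem a hm
    | add x _ y _ hx hy =>
      obtain ⟨s, hs, hsP⟩ := hx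
      obtain ⟨t, ht, htP⟩ := hy
      refine ⟨s * t, ?_, P.asIdeal.primeCompl.mul_mem hsP htP⟩
      rw [smul_add]
      refine add_mem ?_ ?_
      · rw [mul_comm, mul_smul]
        exact I.smul_mem t hs
      · rw [mul_smul]
        exact I.smul_mem s ht
  · rintro ⟨s, hs, hsP⟩
    have hs0 : algebraMap D K s ≠ 0 := fun h ↦ hsP (by
      rw [(FaithfulSMul.algebraMap_eq_zero_iff D K).1 h]; exact zero_mem _)
    have : x = (s • x) * (algebraMap D K 1 * (algebraMap D K s)⁻¹) := by
      rw [Algebra.smul_def, map_one]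
      field_simp
    rw [this]
    exact Submodule.mul_mem_mul hs (hmem.2 ⟨1, s, hsP, rfl⟩)

theorem mem_spectralMap {Y : Set (PrimeSpectrum D)} {I : Submodule D K} {x : K} :
    x ∈ spectralMap K Y I ↔ ∀ P ∈ Y, ¬ I.colon {x} ≤ P.asIdeal := by
  simp [spectralMap, Submodule.mem_iInf, mem_mul_localizationAt]

theorem spectralMap_bot {Y : Set (PrimeSpectrum D)} (hY : Y.Nonempty) :
    spectralMap K Y ⊥ = ⊥ := by
  obtain ⟨P, hP⟩ := hY
  rw [eq_bot_iff]
  refine (iInf₂_le P hP).trans ?_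
  rw [Submodule.bot_mul]

theorem spectralMap_generizations (P : PrimeSpectrum D) :
    spectralMap K (generizations {P}) = spectralMap K {P} := by
  ext I x
  simp only [mem_spectralMap, mem_generizations_singleton, Set.mem_singleton_iff, forall_eq]
  exact ⟨fun h ↦ h P le_rfl, fun h Q hQ hI ↦ h (hI.trans hQ)⟩

variable {K} in
omit [IsDomain D] [IsFractionRing D K] in
theorem Submodule.colon_smul_smul {x : K} (hx : x ≠ 0) (I : Submodule D K) (y : K) :
    (x • I).colon {x * y} = I.colon {y} := by
  ext d
  rw [Submodule.mem_colon_singleton, Submodule.mem_colon_singleton, ← mul_smul_comm]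
  constructor
  · intro h
    obtain ⟨z, hz, hzx⟩ := (Submodule.mem_smul_pointwise_iff_exists _ _ _).1 h
    rwa [← mul_left_cancel₀ hx hzx]
  · intro h
    exact Submodule.smul_mem_pointwise_smul _ x I h

/-- The semistar operation `I ↦ ⋂_{P ∈ Y} I D_P`. -/
noncomputable def spectralSemistar (Y : Set (PrimeSpectrum D)) (hY : Y.Nonempty) :
    SemistarOperation D K where
  toFun := spectralMap K Y
  le_toFun I x hx := by
    rw [mem_spectralMap]
    intro P _ h
    have : I.colon {x} = ⊤ := (Submodule.colon_eq_top_iff_subset _).2 (by simpa using hx)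
    exact P.isPrime.ne_top (top_le_iff.1 (this ▸ h))
  mono I J hIJ := iInf₂_mono fun P _ ↦ mul_le_mul_left hIJ _
  idem I := by
    refine le_antisymm ?_ ?_
    · refine le_iInf₂ fun P hP ↦ (iInf₂_le P hP).trans ?_
      refine (mul_le_mul_left (iInf₂_le P hP) _).trans ?_
      rw [mul_assoc, localizationAt, (Subalgebra.isIdempotentElem_toSubmodule _).eq]
    · intro x hx
      rw [mem_spectralMap] at hx ⊢
      intro P hP h
      refine hx P hP (le_trans (Submodule.colon_mono ?_ le_rfl) h)
      intro y hy
      rw [mem_spectralMap]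
      intro Q _ h
      have : I.colon {y} = ⊤ := (Submodule.colon_eq_top_iff_subset _).2 (by simpa using hy)
      exact Q.isPrime.ne_top (top_le_iff.1 (this ▸ h))
  smul_toFun x I := by
    -- The case `x = 0` needs `Y` nonempty: the empty intersection would send `0` to `K`.
    by_cases hx : x = 0
    · subst hx
      rw [Submodule.zero_pointwise_smul, Submodule.zero_pointwise_smul, spectralMap_bot K hY]
    · ext y
      obtain ⟨y, rfl⟩ : ∃ z, y = x * z := ⟨x⁻¹ * y, by field_simp⟩
      rw [mem_spectralMap, Submodule.colon_smul_smul hx, ← mem_spectralMap]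
      constructor
      · intro h
        obtain ⟨z, hz, hzx⟩ := (Submodule.mem_smul_pointwise_iff_exists _ _ _).1 h
        rwa [← mul_left_cancel₀ hx hzx]
      · intro h
        exact Submodule.smul_mem_pointwise_smul _ x _ h

/-- Colons commute with intersections, and a prime contains `𝔞 ∩ 𝔟` iff it contains `𝔞` or `𝔟`. -/
theorem isStable_spectralSemistar (Y : Set (PrimeSpectrum D)) (hY : Y.Nonempty) :
    (spectralSemistar K Y hY).IsStable := by
  intro I J _ _
  ext x
  simp only [spectralSemistar, Submodule.mem_inf, mem_spectralMap, Submodule.inf_colon,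
    ← forall₂_and]
  refine forall₂_congr fun P _ ↦ ?_
  rw [P.isPrime.inf_le, not_or]

theorem isFiniteType_spectralSemistar (Y : InverseClosed (PrimeSpectrum D)) :
    (spectralSemistar K Y.carrier Y.nonempty).IsFiniteType := by
  intro I _
  refine Set.Subset.antisymm (fun x hx ↦ ?_) ?_
  · have hx' := (mem_spectralMap K).1 hx
    -- Finitely many `D(s)` with `s ∈ (I : x)` cover `Y`; the corresponding `s • x` span the
    -- required `J ⊆ I`.
    have hcover : Y.carrier ⊆ ⋃ s : I.colon {x}, (basicOpen (s : D) : Set (PrimeSpectrum D)) := by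
      intro P hP
      obtain ⟨s, hs, hsP⟩ := SetLike.not_le_iff_exists.1 (hx' P hP)
      exact Set.mem_iUnion.2 ⟨⟨s, hs⟩, hsP⟩
    obtain ⟨t, ht⟩ := Y.isCompact.elim_finite_subcover _ (fun _ ↦ isOpen_basicOpen) hcover
    have hfin : ((fun s : I.colon {x} ↦ (s : D) • x) '' (t : Set (I.colon {x}))).Finite :=
      t.finite_toSet.image _
    refine Set.mem_biUnion (x := Submodule.span D _)
      ⟨Submodule.span_le.2 ?_, Submodule.fg_span hfin⟩ ((mem_spectralMap K).2 fun P hP h ↦ ?_)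
    · rintro _ ⟨s, -, rfl⟩
      exact Submodule.mem_colon_singleton.1 s.2
    · obtain ⟨s, hs, hsP⟩ := Set.mem_iUnion₂.1 (ht hP)
      exact hsP (h (Submodule.mem_colon_singleton.2 (Submodule.subset_span ⟨s, hs, rfl⟩)))
  · simp only [Set.iUnion_subset_iff]
    exact fun J hJ ↦ (spectralSemistar K Y.carrier Y.nonempty).mono _ _ hJ.1

end SpectralMap

/-! ### Stable semistar operations of finite type -/

namespace SemistarOperation

section

variable {D K : Type*} [CommRing D] [Field K] [Algebra D K]

/-- The ideals `𝔞` of `D` with `1 ∈ 𝔞^⋆`. -/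
def localizingSystem (star : SemistarOperation D K) : Set (Ideal D) :=
  {𝔞 | (1 : K) ∈ star.toFun (Submodule.map (Algebra.linearMap D K) 𝔞)}

variable (star : SemistarOperation D K)

theorem toFun_bot : star.toFun ⊥ = ⊥ := by
  have h := star.smul_toFun 0 ⊥
  rw [Submodule.zero_pointwise_smul, Submodule.zero_pointwise_smul] at h
  exact h.symm

variable {star}

theorem mem_localizingSystem {𝔞 : Ideal D} :
    𝔞 ∈ star.localizingSystem ↔ (1 : K) ∈ star.toFun (Submodule.map (Algebra.linearMap D K) 𝔞) := Iff.rfl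

theorem localizingSystem_mono {𝔞 𝔟 : Ideal D} (h : 𝔞 ≤ 𝔟) (h𝔞 : 𝔞 ∈ star.localizingSystem) :
    𝔟 ∈ star.localizingSystem :=
  star.mono _ _ (Submodule.map_mono h) h𝔞

theorem top_mem_localizingSystem : ⊤ ∈ star.localizingSystem :=
  star.le_toFun _ ⟨1, trivial, by simp⟩

theorem bot_notMem_localizingSystem : ⊥ ∉ star.localizingSystem := by
  simp [mem_localizingSystem, toFun_bot]

/-- For `x ≠ 0`, `(I : x) = x⁻¹I ∩ D`, so stability and homogeneity apply. The case `I = 0` is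
separate because stability only concerns nonzero submodules. -/
theorem IsStable.mem_toFun_iff (hs : star.IsStable) {I : Submodule D K} {x : K} :
    x ∈ star.toFun I ↔ I.colon {x} ∈ star.localizingSystem := by
  by_cases hx : x = 0
  · subst hx
    rw [Submodule.colon_singleton_zero]
    exact iff_of_true (zero_mem _) top_mem_localizingSystem
  have hsmul : ∀ (J : Submodule D K) (y : K), y ∈ x⁻¹ • J ↔ x * y ∈ J := by
    intro J y
    rw [Submodule.mem_smul_pointwise_iff_exists]
    constructor
    · rintro ⟨z, hz, rfl⟩
      rwa [smul_eq_mul, mul_inv_cancel_left₀ hx]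
    · intro h
      exact ⟨_, h, inv_mul_cancel_left₀ hx y⟩
  by_cases hI : I = ⊥
  · subst hI
    have hcolon : Submodule.map (Algebra.linearMap D K) ((⊥ : Submodule D K).colon {x}) = ⊥ := by
      rw [eq_bot_iff]
      rintro _ ⟨d, hd, rfl⟩
      have : d • x = 0 := Submodule.mem_colon_singleton.1 hd
      rw [Algebra.smul_def, mul_eq_zero, or_iff_left hx] at this
      simpa using this
    rw [mem_localizingSystem, hcolon, toFun_bot]
    simp [hx]
  have hcolon : Submodule.map (Algebra.linearMap D K) (I.colon {x}) =
      x⁻¹ • I ⊓ Submodule.map (Algebra.linearMap D K) (⊤ : Ideal D) := by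
    ext y
    simp only [Submodule.mem_map, Submodule.mem_inf, hsmul, Submodule.mem_colon_singleton,
      Algebra.linearMap_apply, Submodule.mem_top, true_and]
    constructor
    · rintro ⟨d, hd, rfl⟩
      refine ⟨?_, d, rfl⟩
      rwa [mul_comm, ← Algebra.smul_def]
    · rintro ⟨h, d, rfl⟩
      refine ⟨d, ?_, rfl⟩
      rwa [Algebra.smul_def, mul_comm]
  have hI' : x⁻¹ • I ≠ ⊥ := by
    obtain ⟨y, hy, hy0⟩ := Submodule.exists_mem_ne_zero_of_ne_bot hI
    refine fun h ↦ hy0 ?_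
    have : x⁻¹ * y ∈ x⁻¹ • I := Submodule.smul_mem_pointwise_smul _ _ _ hy
    rw [h, Submodule.mem_bot, mul_eq_zero] at this
    exact this.resolve_left (inv_ne_zero hx)
  have htop : Submodule.map (Algebra.linearMap D K) (⊤ : Ideal D) ≠ ⊥ := by
    intro h
    have : (1 : K) ∈ Submodule.map (Algebra.linearMap D K) (⊤ : Ideal D) := ⟨1, trivial, by simp⟩
    rw [h] at this
    simp at this
  rw [mem_localizingSystem, hcolon, hs _ _ hI' htop, Submodule.mem_inf, ← star.smul_toFun, hsmul,
    mul_one]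
  exact (and_iff_left top_mem_localizingSystem).symm

theorem IsFiniteType.exists_fg (hf : star.IsFiniteType) {𝔞 : Ideal D}
    (h𝔞 : 𝔞 ∈ star.localizingSystem) : ∃ 𝔟 ≤ 𝔞, 𝔟.FG ∧ 𝔟 ∈ star.localizingSystem := by
  by_cases h0 : Submodule.map (Algebra.linearMap D K) 𝔞 = ⊥
  · rw [mem_localizingSystem, h0, toFun_bot] at h𝔞
    simp at h𝔞
  · have h1 : (1 : K) ∈ (star.toFun (Submodule.map (Algebra.linearMap D K) 𝔞) : Set K) := h𝔞
    rw [hf _ h0] at h1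
    obtain ⟨J, ⟨hJ, t, rfl⟩, h1J⟩ := Set.mem_iUnion₂.1 h1
    -- The finitely many generators of `J` lift to elements of `𝔞`.
    obtain ⟨u, hu, hufin, hut⟩ := (Set.exists_subset_image_finite_and
      (p := fun s ↦ s = (t : Set K))).1 ⟨t, Submodule.span_le.1 hJ, t.finite_toSet, rfl⟩
    exact ⟨Ideal.span u, Ideal.span_le.2 hu, Submodule.fg_span hufin, by
      rwa [mem_localizingSystem, Ideal.span, Submodule.map_span, hut]⟩

/-- The hypothesis on colons says `𝔟 ⊆ 𝔞^⋆`; idempotence then gives `1 ∈ 𝔟^⋆ ⊆ 𝔞^⋆`. -/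
theorem IsStable.mem_localizingSystem_of_colon (hs : star.IsStable) {𝔞 𝔟 : Ideal D}
    (h𝔟 : 𝔟 ∈ star.localizingSystem)
    (h : ∀ b ∈ 𝔟, 𝔞.colon {b} ∈ star.localizingSystem) : 𝔞 ∈ star.localizingSystem := by
  have hle : Submodule.map (Algebra.linearMap D K) 𝔟 ≤ star.toFun (Submodule.map (Algebra.linearMap D K) 𝔞) := by
    rintro _ ⟨b, hb, rfl⟩
    rw [hs.mem_toFun_iff]
    refine localizingSystem_mono (fun d hd ↦ ?_) (h b hb)
    exact Submodule.mem_colon_singleton.2 ⟨d • b, Submodule.mem_colon_singleton.1 hd, by simp [Algebra.smul_def]⟩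
  have := star.mono _ _ hle h𝔟
  rwa [star.idem] at this

/-- For `b = c + ea` with `c ∈ I`, every element of `(I : a)` multiplies `b` into `I`. The Oka
property makes ideals maximal outside the family prime. -/
theorem IsStable.isOka (hs : star.IsStable) : Ideal.IsOka (· ∈ star.localizingSystem) where
  top := top_mem_localizingSystem
  oka {I a} hsup hcolon := by
    refine hs.mem_localizingSystem_of_colon hsup fun b hb ↦ ?_
    refine localizingSystem_mono (fun d hd ↦ ?_) hcolon
    rw [Ideal.mem_colon_span_singleton] at hd
    obtain ⟨c, hc, e, he, rfl⟩ := Submodule.mem_sup.1 hb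
    obtain ⟨e, rfl⟩ := Ideal.mem_span_singleton'.1 he
    rw [Submodule.mem_colon_singleton, smul_eq_mul, mul_add]
    refine add_mem (I.mul_mem_left _ hc) ?_
    rw [mul_left_comm]
    exact I.mul_mem_left _ hd

theorem exists_isPrime_of_notMem (hs : star.IsStable) (hf : star.IsFiniteType) {𝔞 : Ideal D}
    (h𝔞 : 𝔞 ∉ star.localizingSystem) :
    ∃ P : PrimeSpectrum D, 𝔞 ≤ P.asIdeal ∧ P.asIdeal ∉ star.localizingSystem := by
  have hchain : ∀ C ⊆ {I | I ∉ star.localizingSystem}, IsChain (· ≤ ·) C → ∀ J ∈ C,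
      ∃ I ∈ {I | I ∉ star.localizingSystem}, ∀ z ∈ C, z ≤ I := by
    -- If the supremum of a chain were in the family, so would be a finitely generated subideal,
    -- hence some member of the chain.
    refine fun C hC hchain J hJ ↦ ⟨sSup C, fun hsup ↦ ?_, fun _ ↦ le_sSup⟩
    obtain ⟨𝔟, h𝔟, h𝔟fg, h𝔟s⟩ := hf.exists_fg hsup
    obtain ⟨I, hI, hle⟩ := (CompleteLattice.isCompactElement_iff_le_of_directed_sSup_le _ _).1
      ((Submodule.fg_iff_compact 𝔟).1 h𝔟fg) C ⟨J, hJ⟩ hchain.directedOn h𝔟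
    exact hC hI (localizingSystem_mono hle h𝔟s)
  obtain ⟨M, hM, hmax⟩ := zorn_le_nonempty₀ _ hchain 𝔞 h𝔞
  exact ⟨⟨M, hs.isOka.isPrime_of_maximal_not hmax⟩, hM, hmax.prop⟩

end

section

variable {D K : Type*} [CommRing D] [Field K] [Algebra D K] [FaithfulSMul D K]
  {star : SemistarOperation D K}

theorem IsStable.mem_qSpec_iff (hs : star.IsStable) {P : PrimeSpectrum D} :
    P ∈ star.qSpec ↔ P.asIdeal ∉ star.localizingSystem := by
  constructor
  · intro h h1
    refine P.isPrime.ne_top ((Ideal.eq_top_iff_one _).2 ?_)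
    rw [← show _ = _ from h, Submodule.mem_comap, Algebra.linearMap_apply, map_one]
    exact h1
  · intro h
    refine le_antisymm (fun d hd ↦ ?_) fun d hd ↦ star.le_toFun _ ⟨d, hd, rfl⟩
    by_contra hdP
    rw [Submodule.mem_comap, hs.mem_toFun_iff] at hd
    -- Primality gives `(P : d) ⊆ P` for `d ∉ P`.
    refine h (localizingSystem_mono (fun e he ↦ ?_) hd)
    obtain ⟨p, hp, hpe⟩ := Submodule.mem_colon_singleton.1 he
    have : p = e * d := by
      apply FaithfulSMul.algebraMap_injective D K
      simpa [Algebra.smul_def] using hpe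
    exact (P.isPrime.mem_or_mem (this ▸ hp)).resolve_right hdP

theorem mem_localizingSystem_iff (hs : star.IsStable) (hf : star.IsFiniteType) {𝔞 : Ideal D} :
    𝔞 ∈ star.localizingSystem ↔ star.qSpec ⊆ (zeroLocus (𝔞 : Set D))ᶜ := by
  constructor
  · intro h P hP hle
    exact hs.mem_qSpec_iff.1 hP (localizingSystem_mono hle h)
  · intro h
    by_contra h𝔞
    obtain ⟨P, hle, hP⟩ := exists_isPrime_of_notMem hs hf h𝔞
    exact h (hs.mem_qSpec_iff.2 hP) hle

end

variable {D K : Type*} [CommRing D] [IsDomain D] [Field K] [Algebra D K] [IsFractionRing D K]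

theorem eq_spectralMap {star : SemistarOperation D K} (hs : star.IsStable)
    (hf : star.IsFiniteType) : star.toFun = spectralMap K star.qSpec := by
  ext I x
  rw [hs.mem_toFun_iff, mem_localizingSystem_iff hs hf, mem_spectralMap]
  rfl

/-- The quasi-spectrum of a stable semistar operation of finite type, as an inverse-closed set. -/
def qSpecInverseClosed (star : SemistarOperation D K) (hs : star.IsStable)
    (hf : star.IsFiniteType) : InverseClosed (PrimeSpectrum D) where
  carrier := star.qSpec
  nonempty := ⟨⟨⊥, Ideal.isPrime_bot⟩, hs.mem_qSpec_iff.2 bot_notMem_localizingSystem⟩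
  inverseClosure_eq := by
    refine Set.Subset.antisymm (fun P hP ↦ ?_) fun P hP U hU ↦ hU.2.2 hP
    rw [hs.mem_qSpec_iff]
    intro h
    -- `D(𝔟)` is a quasi-compact open set containing the quasi-spectrum but missing `P`.
    obtain ⟨𝔟, h𝔟, h𝔟fg, h𝔟s⟩ := hf.exists_fg h
    obtain ⟨hc, ho⟩ := isCompact_isOpen_iff_ideal.2 ⟨𝔟, h𝔟fg, rfl⟩
    exact hP _ ⟨ho, hc, (mem_localizingSystem_iff hs hf).1 h𝔟s⟩ h𝔟

/-- Since `(P : 1) = P`, the prime `P` is in the quasi-spectrum iff it lies below some `Q ∈ Y`, and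
`Y` is closed under generization. -/
theorem qSpec_spectralSemistar (Y : InverseClosed (PrimeSpectrum D)) :
    (spectralSemistar K Y.carrier Y.nonempty).qSpec = Y.carrier := by
  ext P
  rw [(isStable_spectralSemistar K _ Y.nonempty).mem_qSpec_iff, mem_localizingSystem]
  have hcolon : (Submodule.map (Algebra.linearMap D K) P.asIdeal).colon {1} = P.asIdeal := by
    ext d
    simp [Submodule.mem_colon_singleton, Algebra.smul_def]
  simp only [spectralSemistar, mem_spectralMap, hcolon, not_forall, not_not]
  constructor
  · rintro ⟨Q, hQ, hPQ⟩
    exact Y.mem_of_mem_closure hQ ((le_iff_mem_closure P Q).1 hPQ)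
  · intro hP
    exact ⟨P, hP, le_rfl⟩

end SemistarOperation

open SemistarOperation

/-- The homeomorphism between the nonempty inverse-closed subsets of the spectrum and the stable
semistar operations of finite type. -/
noncomputable def spectralHomeomorph (D K : Type*) [CommRing D] [IsDomain D] [Field K]
    [Algebra D K] [IsFractionRing D K] :
    InverseClosed (PrimeSpectrum D) ≃ₜ StableFiniteTypeSemistar D K where
  toFun Y := ⟨spectralSemistar K Y.carrier Y.nonempty, isStable_spectralSemistar K _ _,
    isFiniteType_spectralSemistar K Y⟩
  invFun star := qSpecInverseClosed star.1 star.2.1 star.2.2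
  left_inv Y := InverseClosed.ext (qSpec_spectralSemistar Y)
  right_inv star :=
    Subtype.ext (SemistarOperation.ext (eq_spectralMap star.2.1 star.2.2).symm)
  continuous_toFun := by
    refine continuous_induced_rng.2 (continuous_generateFrom_iff.2 ?_)
    rintro _ ⟨F, -, rfl⟩
    have : {Y : InverseClosed (PrimeSpectrum D) |
        Y.carrier ⊆ (zeroLocus (F.colon {(1 : K)} : Set D))ᶜ} =
        (fun Y ↦ spectralSemistar K Y.carrier Y.nonempty) ⁻¹' {star | (1 : K) ∈ star.toFun F} := by
      ext Y
      exact (mem_spectralMap K).symm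
    exact this ▸ InverseClosed.isOpen_setOf_subset (isClosed_zeroLocus _).isOpen_compl
  continuous_invFun := by
    refine continuous_generateFrom_iff.2 ?_
    rintro _ ⟨Ω, hΩ, hΩc, rfl⟩
    obtain ⟨𝔞, -, rfl⟩ := isCompact_isOpen_iff_ideal.1 ⟨hΩc, hΩ⟩
    have : Subtype.val ⁻¹' {star : SemistarOperation D K | 𝔞 ∈ star.localizingSystem} =
        (fun star : StableFiniteTypeSemistar D K ↦
          qSpecInverseClosed star.1 star.2.1 star.2.2) ⁻¹'
          {Y | Y.carrier ⊆ (zeroLocus (𝔞 : Set D))ᶜ} := by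
      ext star
      exact mem_localizingSystem_iff star.2.1 star.2.2
    rw [← this]
    refine IsOpen.preimage continuous_subtype_val ?_
    -- Subbasic open sets require a nonzero submodule; for `𝔞 = 0` the set is empty because `0^⋆ =
    -- 0`.
    by_cases h : Submodule.map (Algebra.linearMap D K) 𝔞 = ⊥
    · convert isOpen_empty
      refine Set.eq_empty_iff_forall_notMem.2 fun star hstar ↦ ?_
      have : (1 : K) ∈ star.toFun (Submodule.map (Algebra.linearMap D K) 𝔞) := hstar
      simp [h, toFun_bot] at this
    · exact isOpen_generateFrom_of_mem ⟨_, h, rfl⟩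

theorem proposition5p3 (D K : Type*) [CommRing D] [IsDomain D] [Field K] [Algebra D K]
    [IsFractionRing D K] :
    ∃ (sSharp : InverseClosed (PrimeSpectrum D) ≃ₜ StableFiniteTypeSemistar D K)
      (φ : PrimeSpectrum D → InverseClosed (PrimeSpectrum D))
      (s : PrimeSpectrum D → StableFiniteTypeSemistar D K),
      (∀ Y, (sSharp Y).1.toFun = spectralMap K Y.carrier) ∧
      (∀ star, (sSharp.symm star).carrier = star.1.qSpec) ∧
      (∀ P, (φ P).carrier = generizations {P}) ∧
      (∀ P, (s P).1.toFun = spectralMap K {P}) ∧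
      sSharp ∘ φ = s := by
  refine ⟨spectralHomeomorph D K, InverseClosed.down,
    fun P ↦ spectralHomeomorph D K (InverseClosed.down P), fun _ ↦ rfl, fun _ ↦ rfl, fun _ ↦ rfl,
    fun P ↦ spectralMap_generizations K P, rfl⟩
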